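/- Let $t\ge 2$, let $\mathcal X_1,\dots,\mathcal X_t,\mathcal S,\mathcal Y$ be finite sets, and let $W=W_{Y|X_1\cdots X_tS}$ be a $t$-user arbitrarily varying multiple-access channel (AV-MAC): a conditional probability distribution $W(y\mid x_1,\dots,x_t,s)$ on $\mathcal Y$ given inputs $x_j\in\mathcal X_j$ and a state $s\in\mathcal S$, with a distinguished no-adversary state $s_0\in\mathcal S$. It acts memorylessly on blocks, $W(\mathbf y\mid \mathbf x_1,\dots,\mathbf x_t,\mathbf s)=\prod_k W(y_k\mid x_{1,k},\dots,x_{t,k},s_k)$; write $\mathbf s_0=(s_0,\dots,s_0)$. An $(M_1,\dots,M_t,n)$ authentication code consists of encoders $f_j:[M_j]\to\mathcal X_j^n$ for $1\le j\le t$ and a decoder $\phi:\mathcal Y^n\to\prod_{j=1}^t([M_j]\cup\{0\})$. Let $\gamma\in(0,1)$. For a message tuple $\mathbf i\in\prod_j[M_j]$ with encoding $\mathbf x(\mathbf i)=(f_1(i_1),\dots,f_t(i_t))$, let $$A_{\mathbf i}=\{\hat{\mathbf i}\in\textstyle\prod_j([M_j]\cup\{0\}) : \hat i_j\in\{0,i_j\}\text{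 for all }j,\ |\{j:\hat i_j\ne 0\}|\ge\lceil\gamma t\rceil\}.$$ For $\mathbf s\in\mathcal S^n$ the probability of $\gamma$ partial correction error is $e_\gamma(\mathbf i,\mathbf s_0)=W(\phi^{-1}(\{\mathbf i\})^c\mid\mathbf x(\mathbf i),\mathbf s_0)$ and, if $\mathbf s\ne\mathbf s_0$, $e_\gamma(\mathbf i,\mathbf s)=W(\phi^{-1}(A_{\mathbf i})^c\mid\mathbf x(\mathbf i),\mathbf s)$; its average is $e_\gamma(\mathbf s)=\frac1{M_1\cdots M_t}\sum_{\mathbf i}e_\gamma(\mathbf i,\mathbf s)$. A rate tuple $(R_1,\dots,R_t)\in\mathbb R_{\ge0}^t$ is achievable for $\gamma$ partial correction if there is a sequence, indexed by all block lengths $n$, of $(\lceil 2^{R_1n}\rceil,\dots,\lceil 2^{R_tn}\rceil,n)$ authentication codes with $\max_{\mathbf s\in\mathcal S^n}e_\gamma(\mathbf s)\to0$ as $n\to\infty$. The $\gamma$ partially correcting authentication capacity region $\mathscr C_{\mathrm{auth},\gamma}$ is the closure of the set of achievable rate tuples; it is said to have nonempty interior if it contains a point all of whose coordinates are positive. **Lemma.**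 Let $n\ge1$. Suppose that there is an $(M_1,\dots,M_t,n)$ authentication code for $W$ with $M_j>1$ for all $j\in[t]$ whose probability of $\gamma$ partial correction error is zero, i.e. $e_\gamma(\mathbf i,\mathbf s)=0$ for all message tuples $\mathbf i$ and all $\mathbf s\in\mathcal S^n$. Then $\mathscr C_{\mathrm{auth},\gamma}$ has nonempty interior, i.e. it contains a rate tuple all of whose coordinates are positive. -/

import Mathlib

open Filter Topology

noncomputable section

/-- A (discrete memoryless) `t`-user arbitrarily varying multiple-access channel with input
alphabets `X j`, state set `S` and output alphabet `Y`: a conditional distribution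
`W(y | x_1, …, x_t, s)` together with the distinguished no-adversary state `s₀`. -/
structure AVMAC {t : ℕ} (X : Fin t → Type*) (S Y : Type*) [Fintype Y] where
  /-- `W x s y` is the probability of output `y` given inputs `x` and state `s`. -/
  W : (∀ j, X j) → S → Y → ℝ
  nonneg : ∀ x s y, 0 ≤ W x s y
  sum_eq_one : ∀ x s, ∑ y, W x s y = 1
  /-- The no-adversary state. -/
  s₀ : S

/-- An `(M_1, …, M_t, n)` authentication code: deterministic encoders and a decoder, where the
decoder output `none` in a coordinate is the symbol `0` (adversarial interference declared). -/
structure AuthCode {t : ℕ} (X : Fin t → Type*) (Y : Type*) (M : Fin t → ℕ) (n : ℕ) where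
  enc : ∀ j, Fin (M j) → (Fin n → X j)
  dec : (Fin n → Y) → ∀ j, Option (Fin (M j))

namespace AVMAC

variable {t : ℕ} {X : Fin t → Type*} {S Y : Type*} [Fintype Y]

/-- The memoryless extension `W(𝐲 | 𝐱_1, …, 𝐱_t, 𝐬) = ∏ₖ W(y_k | x_{1,k}, …, x_{t,k}, s_k)`. -/
def blockW (V : AVMAC X S Y) {n : ℕ} (x : ∀ j, Fin n → X j) (s : Fin n → S)
    (y : Fin n → Y) : ℝ :=
  ∏ k, V.W (fun j => x j k) (s k) (y k)

/-- `W(B | 𝐱, 𝐬)`, the probability that the output sequence lies in the set `B`. -/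
def blockProb (V : AVMAC X S Y) {n : ℕ} (x : ∀ j, Fin n → X j) (s : Fin n → S)
    (B : Set (Fin n → Y)) : ℝ :=
  ∑ y, B.indicator (V.blockW x s) y

end AVMAC

/-- The set `A_𝐢` of decoded tuples that agree with `𝐢` on each nonzero entry and have at least
`⌈γ t⌉` nonzero entries. -/
def partialCorrectSet {t : ℕ} {M : Fin t → ℕ} (γ : ℝ) (i : ∀ j, Fin (M j)) :
    Set (∀ j, Option (Fin (M j))) :=
  {d | (∀ j, d j = none ∨ d j = some (i j)) ∧
    ⌈γ * (t : ℝ)⌉₊ ≤ (Finset.univ.filter fun j => (d j).isSome = true).card}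

namespace AuthCode

variable {t : ℕ} {X : Fin t → Type*} {S Y : Type*} [Fintype Y] {M : Fin t → ℕ} {n : ℕ}

/-- The encoding `𝐱(𝐢)` of a message tuple. -/
def encode (C : AuthCode X Y M n) (i : ∀ j, Fin (M j)) : ∀ j, Fin n → X j :=
  fun j => C.enc j (i j)

open Classical in
/-- The probability `e_γ(𝐢, 𝐬)` of `γ` partial correction error for the message tuple `𝐢` and
state sequence `𝐬`: when the adversary is absent, all messages have to be decoded correctly;
otherwise the decoded tuple has to lie in `A_𝐢`. -/
def err (C : AuthCode X Y M n) (V : AVMAC X S Y) (γ : ℝ) (i : ∀ j, Fin (M j))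
    (s : Fin n → S) : ℝ :=
  if s = fun _ => V.s₀ then
    V.blockProb (C.encode i) s (C.dec ⁻¹' {fun j => some (i j)})ᶜ
  else
    V.blockProb (C.encode i) s (C.dec ⁻¹' partialCorrectSet γ i)ᶜ

/-- The average probability of error `e_γ(𝐬)` over uniformly distributed message tuples. -/
def avgErr (C : AuthCode X Y M n) (V : AVMAC X S Y) (γ : ℝ) (s : Fin n → S) : ℝ :=
  (∏ j, (M j : ℝ))⁻¹ * ∑ i, C.err V γ i s

/-- `max_𝐬 e_γ(𝐬)`. -/
def maxErr (C : AuthCode X Y M n) (V : AVMAC X S Y) (γ : ℝ) : ℝ :=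
  ⨆ s : Fin n → S, C.avgErr V γ s

end AuthCode

namespace AVMAC

variable {t : ℕ} {X : Fin t → Type*} {S Y : Type*} [Fintype Y]

/-- A rate tuple is achievable for `γ` partial correction if there is a sequence of
`(2^{R_1 n}, …, 2^{R_t n}, n)` codes (sizes rounded up to integers), one for each block length
`n`, whose maximal average error probability tends to `0`. -/
def Achievable (V : AVMAC X S Y) (γ : ℝ) (R : Fin t → ℝ) : Prop :=
  (∀ j, 0 ≤ R j) ∧
  ∃ C : ∀ n : ℕ, AuthCode X Y (fun j => ⌈(2 : ℝ) ^ (R j * (n : ℝ))⌉₊) n,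
    Tendsto (fun n => (C n).maxErr V γ) atTop (𝓝 0)

/-- The `γ` partially correcting authentication capacity region. -/
def capacityRegion (V : AVMAC X S Y) (γ : ℝ) : Set (Fin t → ℝ) :=
  closure {R | V.Achievable γ R}

end AVMAC

/-- The convention for rate regions: a region has nonempty interior if it contains a point all
of whose coordinates are positive. -/
def RegionHasNonemptyInterior {t : ℕ} (𝒞 : Set (Fin t → ℝ)) : Prop :=
  ∃ R ∈ 𝒞, ∀ j, 0 < R j

end

/-!
The given code is used as the inner code of a concatenated code that still has error probability
exactly zero.

Cut a long block into sub-blocks of length `n`. In every sub-block the given decoder returns, for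
each user, either the correct symbol or an erasure, and at least `⌈γ t⌉` users are not erased.
User `j` encodes its message by an outer binary code whose bits select one of two inner messages.
The outer codes are chosen *jointly separating* (`JointlySeparating`): if `a` and `b` are message
tuples that differ for every user, then in some sub-block the outer code symbols of `a j` and `b j`
differ for all users `j` simultaneously. A union bound (`exists_jointlySeparating`) gives such codes
with exponentially many messages.

The outer decoder returns the message of user `j` if it is the only one consistent with the
unerased symbols, and declares interference otherwise. It never returns a wrong message. If fewer
than `⌈γ t⌉` users were decoded, each remaining user `j` would have a wrong consistent message
`b j`; in the sub-block where the true messages and the `b j` are separated simultaneously, all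
these users would be erased, so that fewer than `⌈γ t⌉` users are unerased there: a contradiction
(`concat_err_eq_zero`). Without an adversary no symbol is erased, and all users are decoded.
-/

open Finset

/-! ### Jointly separating binary codes -/

/-- `F ℓ j a` is the `ℓ`-th bit of the codeword of message `a` in the code of user `j`. The codes
are jointly separating if any two tuples of messages that differ for every user have, in some
common position, different bits for every user. -/
def JointlySeparating {t N K : ℕ} (F : Fin N → Fin t → Fin K → Bool) : Prop :=
  ∀ a b : Fin t → Fin K, (∀ j, a j ≠ b j) → ∃ ℓ, ∀ j, F ℓ j (a j) ≠ F ℓ j (b j)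

theorem two_mul_card_filter_apply_ne {α : Type*} [Fintype α] [DecidableEq α] {a b : α}
    (h : a ≠ b) :
    2 * #{c : α → Bool | c a ≠ c b} = Fintype.card (α → Bool) := by
  have hflip : #{c : α → Bool | c a ≠ c b} = #{c : α → Bool | ¬ c a ≠ c b} := by
    -- flipping the value at `a` exchanges the two sets
    refine Finset.card_nbij' (fun c => Function.update c a (!c a))
      (fun c => Function.update c a (!c a)) ?_ ?_ ?_ ?_
    · intro c hc
      simpa [Function.update_of_ne h.symm, Bool.eq_not, Bool.not_eq_eq_eq_not] using hc
    · intro c hc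
      simpa [Function.update_of_ne h.symm, Bool.not_eq_eq_eq_not] using hc
    · intro c _
      simp
    · intro c _
      simp
  rw [← Finset.card_univ,
    ← Finset.card_filter_add_card_filter_not (s := univ) (fun c : α → Bool => c a ≠ c b),
    ← hflip, two_mul]

theorem two_pow_mul_card_filter_forall_apply_ne {t K : ℕ} {a b : Fin t → Fin K}
    (h : ∀ j, a j ≠ b j) :
    2 ^ t * #{c : Fin t → Fin K → Bool | ∀ j, c j (a j) ≠ c j (b j)} =
      Fintype.card (Fin t → Fin K → Bool) := by
  have hpi : ({c : Fin t → Fin K → Bool | ∀ j, c j (a j) ≠ c j (b j)} : Finset _) =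
      Fintype.piFinset fun j => {c : Fin K → Bool | c (a j) ≠ c (b j)} := by
    ext c
    simp
  rw [hpi, Fintype.card_piFinset, Fintype.card_pi,
    ← Finset.prod_congr rfl fun j _ => two_mul_card_filter_apply_ne (h j), Finset.prod_mul_distrib]
  simp

/-- The fraction of all `F` that fail to separate a given pair of tuples is `(1 - 2⁻ᵗ) ^ N`, and
there are at most `K ^ (2 t)` such pairs. -/
theorem exists_jointlySeparating {t N K : ℕ}
    (h : (K : ℝ) ^ (2 * t) * (1 - (2 ^ t)⁻¹) ^ N < 1) :
    ∃ F : Fin N → Fin t → Fin K → Bool, JointlySeparating F := by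
  classical
  by_contra! hno
  set Q := Fintype.card (Fin t → Fin K → Bool) with hQ
  have hQ0 : (0 : ℝ) < Q := by exact_mod_cast Fintype.card_pos
  let pairs : Finset ((Fin t → Fin K) × (Fin t → Fin K)) := {p | ∀ j, p.1 j ≠ p.2 j}
  let bad (p : (Fin t → Fin K) × (Fin t → Fin K)) : Finset (Fin N → Fin t → Fin K → Bool) :=
    Fintype.piFinset fun _ => {c | ¬ ∀ j, c j (p.1 j) ≠ c j (p.2 j)}
  have hcover : (univ : Finset (Fin N → Fin t → Fin K → Bool)) ⊆ pairs.biUnion bad := by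
    intro F _
    have hF := hno F
    unfold JointlySeparating at hF
    push Not at hF
    obtain ⟨a, b, hab, hF⟩ := hF
    refine mem_biUnion.2 ⟨(a, b), by simpa [pairs] using hab, ?_⟩
    simpa [bad] using hF
  have hbad : ∀ p ∈ pairs, (#(bad p) : ℝ) = ((1 - (2 ^ t)⁻¹) * Q) ^ N := by
    intro p hp
    have hp' : ∀ j, p.1 j ≠ p.2 j := by simpa [pairs] using hp
    have h1 := two_pow_mul_card_filter_forall_apply_ne hp'
    have h2 := Finset.card_filter_add_card_filter_not (s := univ)
      (fun c : Fin t → Fin K → Bool => ∀ j, c j (p.1 j) ≠ c j (p.2 j))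
    rw [Finset.card_univ] at h2
    rw [Fintype.card_piFinset, prod_const, card_univ, Fintype.card_fin, Nat.cast_pow]
    congr 1
    rw [← hQ] at h1 h2
    have h1' := congrArg (Nat.cast : ℕ → ℝ) h1
    have h2' := congrArg (Nat.cast : ℕ → ℝ) h2
    push_cast at h1' h2'
    have h3 : (#{c : Fin t → Fin K → Bool | ∀ j, c j (p.1 j) ≠ c j (p.2 j)} : ℝ) =
        (2 ^ t)⁻¹ * Q := by
      rw [← h1']
      field_simp
    rw [sub_mul, one_mul, ← h3]
    linarith
  have hpairs : (#pairs : ℝ) ≤ (K : ℝ) ^ (2 * t) := by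
    have : #pairs ≤ Fintype.card ((Fin t → Fin K) × (Fin t → Fin K)) := card_le_univ _
    have hc : Fintype.card ((Fin t → Fin K) × (Fin t → Fin K)) = K ^ (2 * t) := by
      simp [two_mul, pow_add]
    rw [hc] at this
    exact_mod_cast this
  have hcount : (Q : ℝ) ^ N ≤ ∑ p ∈ pairs, (#(bad p) : ℝ) := by
    have := (card_le_card hcover).trans card_biUnion_le
    rw [card_univ, Fintype.card_fun, Fintype.card_fin] at this
    exact_mod_cast this
  rw [sum_congr rfl hbad, sum_const, nsmul_eq_mul, mul_pow, ← mul_assoc] at hcount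
  have hρ : (0 : ℝ) ≤ (1 - (2 ^ t)⁻¹) ^ N :=
    pow_nonneg (sub_nonneg.2 (inv_le_one_of_one_le₀ (one_le_pow₀ one_le_two))) _
  have hlt : (#pairs : ℝ) * (1 - (2 ^ t)⁻¹) ^ N < 1 :=
    (mul_le_mul_of_nonneg_right hpairs hρ).trans_lt h
  exact absurd (mul_lt_mul_of_pos_right hlt (pow_pos hQ0 N)) (by rw [one_mul]; exact hcount.not_gt)

/-! ### Codes with vanishing error -/

namespace AVMAC

variable {t : ℕ} {X : Fin t → Type*} {S Y : Type*} [Fintype Y]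

theorem blockProb_eq_zero_iff (V : AVMAC X S Y) {n : ℕ} (x : ∀ j, Fin n → X j) (s : Fin n → S)
    (B : Set (Fin n → Y)) :
    V.blockProb x s B = 0 ↔ ∀ y ∈ B, V.blockW x s y = 0 := by
  classical
  have hnn : ∀ y, 0 ≤ V.blockW x s y := fun y => prod_nonneg fun k _ => V.nonneg _ _ _
  unfold blockProb
  rw [sum_eq_zero_iff_of_nonneg fun y _ => Set.indicator_nonneg (fun z _ => hnn z) y]
  simp [Set.indicator_apply_eq_zero]

end AVMAC

theorem some_mem_partialCorrectSet {t : ℕ} {M : Fin t → ℕ} {γ : ℝ} (hγ : γ ≤ 1)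
    (i : ∀ j, Fin (M j)) : (fun j => some (i j)) ∈ partialCorrectSet γ i := by
  refine ⟨fun j => Or.inr rfl, ?_⟩
  simp only [Option.isSome_some, filter_true, card_univ, Fintype.card_fin]
  exact Nat.ceil_le.2 (mul_le_of_le_one_left (Nat.cast_nonneg t) hγ)

namespace AuthCode

variable {t : ℕ} {X : Fin t → Type*} {S Y : Type*} {M : Fin t → ℕ} {n : ℕ}

theorem dec_eq_of_err_eq_zero [Fintype Y] {C : AuthCode X Y M n} {V : AVMAC X S Y} {γ : ℝ}
    {i : ∀ j, Fin (M j)} (h : C.err V γ i (fun _ => V.s₀) = 0) {y : Fin n → Y}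
    (hy : V.blockW (C.encode i) (fun _ => V.s₀) y ≠ 0) : C.dec y = fun j => some (i j) := by
  rw [err, if_pos rfl, AVMAC.blockProb_eq_zero_iff] at h
  by_contra hne
  exact hy (h y hne)

theorem dec_mem_of_err_eq_zero [Fintype Y] {C : AuthCode X Y M n} {V : AVMAC X S Y} {γ : ℝ} (hγ : γ ≤ 1)
    {i : ∀ j, Fin (M j)} {s : Fin n → S} (h : C.err V γ i s = 0) {y : Fin n → Y}
    (hy : V.blockW (C.encode i) s y ≠ 0) : C.dec y ∈ partialCorrectSet γ i := by
  by_cases hs : s = fun _ => V.s₀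
  · subst hs
    rw [dec_eq_of_err_eq_zero h hy]
    exact some_mem_partialCorrectSet hγ i
  · rw [err, if_neg hs, AVMAC.blockProb_eq_zero_iff] at h
    by_contra hne
    exact hy (h y hne)

theorem maxErr_eq_zero [Fintype Y] {C : AuthCode X Y M n} {V : AVMAC X S Y} {γ : ℝ}
    (h : ∀ i s, C.err V γ i s = 0) : C.maxErr V γ = 0 := by
  simp [maxErr, avgErr, h]

/-! ### Concatenation -/

/-- The `ℓ`-th sub-block of length `n` of a block of length `m`. -/
def subblock {m N : ℕ} (hm : N * n ≤ m) {A : Type*} (y : Fin m → A) (ℓ : Fin N) : Fin n → A :=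
  fun r => y ⟨ℓ * n + r, by
    have h1 : (ℓ + 1 : ℕ) * n ≤ N * n := Nat.mul_le_mul_right n ℓ.isLt
    have h2 := r.isLt
    rw [add_mul, one_mul] at h1
    omega⟩

/-- The message `a` of user `j` agrees with all unerased symbols of that user that the inner
decoder returns on the sub-blocks of `y`. -/
def Consistent (C : AuthCode X Y M n) (σ : ∀ j, Bool → Fin (M j)) {m N K : ℕ} (hm : N * n ≤ m)
    (F : Fin N → Fin t → Fin K → Bool) (y : Fin m → Y) (j : Fin t) (a : Fin K) : Prop :=
  ∀ ℓ, C.dec (subblock hm y ℓ) j = none ∨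
    C.dec (subblock hm y ℓ) j = some (σ j (F ℓ j a))

open Classical in
/-- The concatenation of the inner code `C` with the outer binary codes `F`: in sub-block `ℓ`, user
`j` sends the inner message `σ j b`, where `b` is the `ℓ`-th bit of its outer codeword. The letters
after the last complete sub-block carry no information. The decoder returns the message of a user
if it is the only consistent one, and `none` otherwise. -/
noncomputable def concat (C : AuthCode X Y M n) (hn : 0 < n) (σ : ∀ j, Bool → Fin (M j)) {m N K : ℕ}
    (hm : N * n ≤ m) (F : Fin N → Fin t → Fin K → Bool) : AuthCode X Y (fun _ => K) m where
  enc j a k :=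
    C.enc j (σ j (if h : k / n < N then F ⟨k / n, h⟩ j a else true)) ⟨k % n, Nat.mod_lt _ hn⟩
  dec y j := if h : ∃! a, C.Consistent σ hm F y j a then some h.choose else none

variable {C : AuthCode X Y M n} {hn : 0 < n} {σ : ∀ j, Bool → Fin (M j)} {m N K : ℕ}
  {hm : N * n ≤ m} {F : Fin N → Fin t → Fin K → Bool}

theorem subblock_concat_encode (i : Fin t → Fin K) (ℓ : Fin N) (j : Fin t) :
    subblock hm ((C.concat hn σ hm F).encode i j) ℓ = C.encode (fun j => σ j (F ℓ j (i j))) j := by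
  funext r
  have h1 : (ℓ * n + r : ℕ) / n = ℓ := by
    rw [mul_comm, Nat.mul_add_div hn, Nat.div_eq_of_lt r.isLt, add_zero]
  have h2 : (ℓ * n + r : ℕ) % n = r := by
    rw [mul_comm, Nat.mul_add_mod, Nat.mod_eq_of_lt r.isLt]
  simp [subblock, concat, encode, h1, h2]

theorem blockW_subblock_ne_zero [Fintype Y] {V : AVMAC X S Y} {i : Fin t → Fin K} {s : Fin m → S}
    {y : Fin m → Y} (h : V.blockW ((C.concat hn σ hm F).encode i) s y ≠ 0) (ℓ : Fin N) :
    V.blockW (C.encode fun j => σ j (F ℓ j (i j))) (subblock hm s ℓ) (subblock hm y ℓ) ≠ 0 := by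
  unfold AVMAC.blockW at h ⊢
  rw [prod_ne_zero_iff] at h ⊢
  intro r _
  simp_rw [← subblock_concat_encode (C := C) (hn := hn) (hm := hm) (σ := σ) (F := F) i ℓ]
  exact h _ (mem_univ _)

theorem concat_dec_eq_some {y : Fin m → Y} {j : Fin t} {a : Fin K}
    (ha : C.Consistent σ hm F y j a) (huniq : ∀ b, C.Consistent σ hm F y j b → b = a) :
    (C.concat hn σ hm F).dec y j = some a := by
  have h : ∃! a, C.Consistent σ hm F y j a := ⟨a, ha, huniq⟩
  simp only [concat, dif_pos h, huniq _ h.choose_spec.1]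

theorem concat_dec_eq_none {y : Fin m → Y} {j : Fin t} {a b : Fin K}
    (ha : C.Consistent σ hm F y j a) (hb : C.Consistent σ hm F y j b) (hab : b ≠ a) :
    (C.concat hn σ hm F).dec y j = none := by
  have h : ¬ ∃! a, C.Consistent σ hm F y j a := fun h => hab (h.unique hb ha)
  simp only [concat, dif_neg h]

/-- If each user outside the decoded ones has a second consistent message, these users are all
erased in one common sub-block. -/
theorem exists_subblock_forall_eq_none (hσ : ∀ j, Function.Injective (σ j)) (hK : 2 ≤ K)
    (hF : JointlySeparating F) {i : Fin t → Fin K} {y : Fin m → Y}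
    (hi : ∀ j, C.Consistent σ hm F y j (i j)) :
    ∃ ℓ, ∀ j, (C.concat hn σ hm F).dec y j = none → C.dec (subblock hm y ℓ) j = none := by
  have : Nontrivial (Fin K) := Fin.nontrivial_iff_two_le.2 hK
  -- a wrong consistent message where there is one, any wrong message elsewhere
  have hb : ∀ j, ∃ b, i j ≠ b ∧
      ((C.concat hn σ hm F).dec y j = none → C.Consistent σ hm F y j b) := by
    intro j
    by_cases huniq : ∀ b, C.Consistent σ hm F y j b → b = i j
    · obtain ⟨b, hb⟩ := exists_ne (i j)
      exact ⟨b, hb.symm, fun hnone => by simp [concat_dec_eq_some (hi j) huniq] at hnone⟩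
    · push Not at huniq
      obtain ⟨b, hb, hne⟩ := huniq
      exact ⟨b, hne.symm, fun _ => hb⟩
  choose b hne hb using hb
  obtain ⟨ℓ, hℓ⟩ := hF i b hne
  refine ⟨ℓ, fun j hj => (hi j ℓ).resolve_right fun h1 => ?_⟩
  rcases hb j hj ℓ with h2 | h2
  · simp [h1] at h2
  · exact hℓ j (hσ j (Option.some_injective _ (h1.symm.trans h2)))

theorem concat_err_eq_zero [Fintype Y] {V : AVMAC X S Y} {γ : ℝ} (hγ : γ ≤ 1)
    (hC : ∀ (i : ∀ j, Fin (M j)) (s : Fin n → S), C.err V γ i s = 0)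
    (hσ : ∀ j, Function.Injective (σ j)) (hK : 2 ≤ K) (hF : JointlySeparating F)
    (i : Fin t → Fin K) (s : Fin m → S) :
    (C.concat hn σ hm F).err V γ i s = 0 := by
  have hmem : ∀ y, V.blockW ((C.concat hn σ hm F).encode i) s y ≠ 0 → ∀ ℓ,
      C.dec (subblock hm y ℓ) ∈ partialCorrectSet γ fun j => σ j (F ℓ j (i j)) :=
    fun y hy ℓ => dec_mem_of_err_eq_zero hγ (hC _ _) (blockW_subblock_ne_zero hy ℓ)
  unfold err
  split_ifs with hs
  · rw [AVMAC.blockProb_eq_zero_iff]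
    intro y hy
    by_contra hW
    refine hy (funext fun j => ?_)
    obtain ⟨ℓ, hℓ⟩ := exists_subblock_forall_eq_none (hn := hn) hσ hK hF
      fun j ℓ => (hmem y hW ℓ).1 j
    -- a user that is not decoded would be erased in a sub-block without adversary
    have hdec : C.dec (subblock hm y ℓ) = fun j => some (σ j (F ℓ j (i j))) := by
      refine dec_eq_of_err_eq_zero (hC _ _) ?_
      have := blockW_subblock_ne_zero hW ℓ
      rwa [hs] at this
    refine concat_dec_eq_some (fun ℓ => (hmem y hW ℓ).1 j) fun b hb => ?_
    by_contra hne
    have := hℓ j (concat_dec_eq_none (fun ℓ => (hmem y hW ℓ).1 j) hb hne)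
    simp [hdec] at this
  · rw [AVMAC.blockProb_eq_zero_iff]
    intro y hy
    by_contra hW
    have hi : ∀ j, C.Consistent σ hm F y j (i j) := fun j ℓ => (hmem y hW ℓ).1 j
    refine hy ⟨fun j => ?_, ?_⟩
    · by_cases huniq : ∀ b, C.Consistent σ hm F y j b → b = i j
      · exact Or.inr (concat_dec_eq_some (hi j) huniq)
      · push Not at huniq
        obtain ⟨b, hb, hne⟩ := huniq
        exact Or.inl (concat_dec_eq_none (hi j) hb hne)
    · obtain ⟨ℓ, hℓ⟩ := exists_subblock_forall_eq_none (hn := hn) hσ hK hF hi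
      refine (hmem y hW ℓ).2.trans (card_le_card fun j => ?_)
      simp only [mem_filter, mem_univ, true_and, Option.isSome_iff_ne_none]
      exact mt (hℓ j)

end AuthCode

/-! ### The rate -/

/-- At a small enough rate the union bound for jointly separating codes with `⌊m / n⌋` positions
succeeds for all large `m`. -/
theorem exists_rate_eventually_lt_one (t : ℕ) {n : ℕ} (hn : 0 < n) {ρ : ℝ} (h0 : 0 ≤ ρ)
    (h1 : ρ < 1) :
    ∃ R : ℝ, 0 < R ∧
      ∀ᶠ m : ℕ in atTop, (⌈(2 : ℝ) ^ (R * (m : ℝ))⌉₊ : ℝ) ^ (2 * t) * ρ ^ (m / n) < 1 := by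
  -- the choice of `R` makes the growth `A` of the number of pairs per sub-block less than `ρ⁻¹`
  obtain ⟨R, hR, hA⟩ : ∃ R : ℝ, 0 < R ∧ ((2 : ℝ) ^ (R * n)) ^ (2 * t) * ρ < 1 := by
    have hcont : Continuous fun R : ℝ => ((2 : ℝ) ^ (R * n)) ^ (2 * t) * ρ :=
      ((Continuous.rpow continuous_const (by fun_prop) fun _ => Or.inl two_ne_zero).pow _).mul
        continuous_const
    have hlim : ∀ᶠ R : ℝ in 𝓝 0, ((2 : ℝ) ^ (R * n)) ^ (2 * t) * ρ < 1 :=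
      hcont.continuousAt.eventually_lt continuousAt_const (by simpa using h1)
    obtain ⟨R, hA, hR⟩ :=
      ((hlim.filter_mono nhdsWithin_le_nhds).and (self_mem_nhdsWithin (s := Set.Ioi (0 : ℝ)))).exists
    exact ⟨R, hR, hA⟩
  refine ⟨R, hR, ?_⟩
  set A : ℝ := ((2 : ℝ) ^ (R * n)) ^ (2 * t) with hAdef
  have hA0 : 0 < A := by positivity
  have hbound : ∀ m : ℕ, (⌈(2 : ℝ) ^ (R * (m : ℝ))⌉₊ : ℝ) ^ (2 * t) * ρ ^ (m / n) ≤
      2 ^ (2 * t) * A * (A * ρ) ^ (m / n) := by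
    intro m
    have hceil : (⌈(2 : ℝ) ^ (R * (m : ℝ))⌉₊ : ℝ) ≤ 2 * ((2 : ℝ) ^ (R * n)) ^ (m / n + 1) := by
      have hge : (1 : ℝ) ≤ 2 ^ (R * (m : ℝ)) := Real.one_le_rpow one_le_two (by positivity)
      have hle : (2 : ℝ) ^ (R * (m : ℝ)) ≤ ((2 : ℝ) ^ (R * n)) ^ (m / n + 1) := by
        rw [← Real.rpow_natCast, ← Real.rpow_mul two_pos.le]
        refine Real.rpow_le_rpow_of_exponent_le one_le_two ?_
        rw [mul_assoc]
        refine mul_le_mul_of_nonneg_left ?_ hR.le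
        exact_mod_cast (Nat.lt_mul_div_succ m hn).le
      have := (Nat.ceil_lt_add_one (zero_le_one.trans hge)).le
      linarith
    calc (⌈(2 : ℝ) ^ (R * (m : ℝ))⌉₊ : ℝ) ^ (2 * t) * ρ ^ (m / n)
        ≤ (2 * ((2 : ℝ) ^ (R * n)) ^ (m / n + 1)) ^ (2 * t) * ρ ^ (m / n) := by gcongr
      _ = 2 ^ (2 * t) * A * (A * ρ) ^ (m / n) := by
        rw [mul_pow, pow_right_comm, ← hAdef]
        ring
  have htend : Tendsto (fun m : ℕ => 2 ^ (2 * t) * A * (A * ρ) ^ (m / n)) atTop (𝓝 0) := by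
    have := ((tendsto_pow_atTop_nhds_zero_of_lt_one (mul_nonneg hA0.le h0) hA).comp
      (Nat.tendsto_div_const_atTop hn.ne')).const_mul (2 ^ (2 * t) * A)
    simpa using this
  filter_upwards [htend.eventually_lt_const one_pos] with m hm using (hbound m).trans_lt hm

theorem mainTheorem3 {t : ℕ} (ht : 2 ≤ t)
    {X : Fin t → Type*} {S Y : Type*} [∀ j, Finite (X j)] [Finite S] [Fintype Y]
    (V : AVMAC X S Y) (γ : ℝ) (hγ : γ ∈ Set.Ioo (0 : ℝ) 1)
    (n : ℕ) (hn : 1 ≤ n) (M : Fin t → ℕ) (hM : ∀ j, 1 < M j)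
    (C : AuthCode X Y M n)
    (hC : ∀ (i : ∀ j, Fin (M j)) (s : Fin n → S), C.err V γ i s = 0) :
    RegionHasNonemptyInterior (V.capacityRegion γ) := by
  have hn0 : 0 < n := hn
  have hpow : (0 : ℝ) < (2 ^ t)⁻¹ := by positivity
  obtain ⟨R, hR, hev⟩ := exists_rate_eventually_lt_one t hn0 (ρ := 1 - (2 ^ t)⁻¹)
    (sub_nonneg.2 (inv_le_one_of_one_le₀ (one_le_pow₀ one_le_two))) (by linarith)
  -- two inner messages per user, selected by the outer code bit
  let σ : ∀ j, Bool → Fin (M j) := fun j b => ⟨b.toNat, b.toNat_le.trans_lt (hM j)⟩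
  have hσ : ∀ j, Function.Injective (σ j) := fun j b c h =>
    by cases b <;> cases c <;> simp_all [σ]
  have hcode : ∀ m : ℕ, ∃ D : AuthCode X Y (fun _ => ⌈(2 : ℝ) ^ (R * (m : ℝ))⌉₊) m,
      0 < m → (⌈(2 : ℝ) ^ (R * (m : ℝ))⌉₊ : ℝ) ^ (2 * t) * (1 - (2 ^ t)⁻¹) ^ (m / n) < 1 →
        D.maxErr V γ = 0 := by
    intro m
    by_cases h : (⌈(2 : ℝ) ^ (R * (m : ℝ))⌉₊ : ℝ) ^ (2 * t) * (1 - (2 ^ t)⁻¹) ^ (m / n) < 1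
    · obtain ⟨F, hF⟩ := exists_jointlySeparating h
      refine ⟨C.concat hn0 σ (Nat.div_mul_le_self m n) F, fun hm _ =>
        AuthCode.maxErr_eq_zero (AuthCode.concat_err_eq_zero hγ.2.le hC hσ ?_ hF)⟩
      refine Nat.lt_ceil.2 ?_
      rw [Nat.cast_one]
      exact Real.one_lt_rpow one_lt_two (by positivity)
    · exact ⟨C.concat hn0 σ (Nat.div_mul_le_self m n) fun _ _ _ => true, fun _ h' => absurd h' h⟩
  choose D hD using hcode
  refine ⟨fun _ => R, subset_closure ⟨fun _ => hR.le, D, ?_⟩, fun _ => hR⟩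
  refine tendsto_const_nhds.congr' ?_
  filter_upwards [hev, eventually_gt_atTop 0] with m hm hpos using (hD m hpos hm).symm
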